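/- A \emph{countable Borel equivalence relation} (CBER) is an equivalence relation $E$ on a standard Borel space $X$ which is Borel as a subset of $X^2$ and all of whose classes are countable. Let $\mathrm{Aut}_B(E)$ be the group of Borel automorphisms $T$ of $X$ such that $x \mathrel{E} y \iff T(x) \mathrel{E} T(y)$, let $\mathrm{Inn}_B(E)$ be its normal subgroup of those $T$ with $x \mathrel{E} T(x)$ for all $x$, let $\mathrm{Out}_B(E) = \mathrm{Aut}_B(E)/\mathrm{Inn}_B(E)$, and let $p_E\colon \mathrm{Aut}_B(E)\to\mathrm{Out}_B(E)$ be the quotient map. An \emph{outer action} of a countable group $G$ is a morphism $\varphi\colon G\to\mathrm{Out}_B(E)$ for some CBER $E$; a \emph{lift} of it is a morphism $\psi\colon G\to\mathrm{Aut}_B(E)$ with $p_E\circ\psi=\varphi$. A morphism $\psi\colon G\to\mathrm{Aut}_B(E)$ is \emph{class-bijective} if for all $g\in G$ and $x\in X$, $\psi(g)(x)\mathrel{E}x$ implies $\psi(g)(x)=x$. A morphism $f\colon H\to G$ of countable groups has the \emph{class-bijective lifting property} if for every CBER $E$, every class-bijective $\alpha\colon H\to\mathrm{Aut}_B(E)$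 and every $\varphi\colon G\to\mathrm{Out}_B(E)$ with $p_E\circ\alpha=\varphi\circ f$, there is a class-bijective $\psi\colon G\to\mathrm{Aut}_B(E)$ with $p_E\circ\psi=\varphi$ and $\psi\circ f=\alpha$. Let $H$ be a countable group, let $(G_n)_n$ be a countable family of countable groups, let $f_n\colon H\to G_n$ be morphisms (not necessarily injective), and let $G$ be the amalgamated free product of the $G_n$ over $H$, that is, the pushout of the morphisms $f_n$ in the category of groups. (1) If every outer action of $H$ has a class-bijective lift, and each $f_n\colon H\to G_n$ has the class-bijective lifting property, then every outer action of $G$ has a lift. (2) If $H$ and all the $G_n$ are finite, then every outer action of $G$ has a lift. -/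

import Mathlib

/-- A countable Borel equivalence relation on `X` (used for standard Borel spaces `X`): an
equivalence relation which is Borel as a subset of `X × X` and all of whose classes are
countable. -/
structure CBER (X : Type*) [MeasurableSpace X] extends Setoid X where
  measurableSet_rel : MeasurableSet {p : X × X | toSetoid p.1 p.2}
  countable_class : ∀ x : X, {y : X | toSetoid x y}.Countable

namespace CBER

variable {X : Type*} [MeasurableSpace X]

/-- The group `Aut_B(E)` of Borel automorphisms `T` of `X` such that
`x E y ↔ T x E T y`, under composition. -/
def Aut (E : CBER X) : Subgroup (Equiv.Perm X) where
  carrier := {T | (Measurable T ∧ Measurable T.symm) ∧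
    ∀ x y, E.toSetoid x y ↔ E.toSetoid (T x) (T y)}
  one_mem' := ⟨⟨measurable_id, measurable_id⟩, fun _ _ => Iff.rfl⟩
  mul_mem' := by
    rintro S T ⟨⟨hS, hS'⟩, hSE⟩ ⟨⟨hT, hT'⟩, hTE⟩
    exact ⟨⟨hS.comp hT, hT'.comp hS'⟩, fun x y => (hTE x y).trans (hSE (T x) (T y))⟩
  inv_mem' := by
    rintro T ⟨⟨hT, hT'⟩, hTE⟩
    refine ⟨⟨hT', hT⟩, fun x y => ?_⟩
    simpa using (hTE (T⁻¹ x) (T⁻¹ y)).symm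

/-- The group `Inn_B(E)` of those `T` in `Aut_B(E)` with `x E T x` for all `x`. -/
def Inn (E : CBER X) : Subgroup E.Aut where
  carrier := {T | ∀ x, E.toSetoid x (T.1 x)}
  one_mem' := fun x => E.toSetoid.refl x
  mul_mem' := by
    intro S T hS hT x
    exact E.toSetoid.trans (hT x) (hS (T.1 x))
  inv_mem' := by
    intro T hT x
    have h := hT (T.1⁻¹ x)
    rw [show T.1 (T.1⁻¹ x) = x from Equiv.apply_symm_apply _ x] at h
    exact E.toSetoid.symm h

instance Inn_normal (E : CBER X) : E.Inn.Normal where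
  conj_mem := by
    intro T hT S x
    have h := (S.2.2 _ _).1 (hT (S.1⁻¹ x))
    rw [show S.1 (S.1⁻¹ x) = x from Equiv.apply_symm_apply _ x] at h
    exact h

/-- The outer automorphism group `Out_B(E) = Aut_B(E) / Inn_B(E)`. -/
abbrev Out (E : CBER X) : Type _ := E.Aut ⧸ E.Inn

/-- The quotient morphism `p_E : Aut_B(E) → Out_B(E)`. -/
def proj (E : CBER X) : E.Aut →* E.Out := QuotientGroup.mk' E.Inn

/-- A morphism `G → Aut_B(E)`, i.e. an action of `G` on `X` by Borel automorphisms of `E`, is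
class-bijective if `g • x E x` implies `g • x = x`. -/
def ClassBijective {G : Type*} [Group G] (E : CBER X) (ψ : G →* E.Aut) : Prop :=
  ∀ (g : G) (x : X), E.toSetoid ((ψ g).1 x) x → (ψ g).1 x = x

end CBER

/-- Every outer action of `G` (a morphism `G → Out_B(E)`, for `E` a CBER on a standard Borel
space) has a lift, i.e. factors through `p_E : Aut_B(E) → Out_B(E)`. -/
def EveryOuterActionLifts.{u, v} (G : Type v) [Group G] : Prop :=
  ∀ (X : Type u) [MeasurableSpace X] [StandardBorelSpace X] (E : CBER X) (φ : G →* E.Out),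
    ∃ ψ : G →* E.Aut, E.proj.comp ψ = φ

/-- Every outer action of `G` has a class-bijective lift. -/
def EveryOuterActionLiftsClassBijectively.{u, v} (G : Type v) [Group G] : Prop :=
  ∀ (X : Type u) [MeasurableSpace X] [StandardBorelSpace X] (E : CBER X) (φ : G →* E.Out),
    ∃ ψ : G →* E.Aut, E.proj.comp ψ = φ ∧ E.ClassBijective ψ

/-- The class-bijective lifting property of a morphism `f : H → G`: for every CBER `E`, every
commutative square formed by `f`, a class-bijective `α : H → Aut_B(E)`, a morphism
`φ : G → Out_B(E)` and `p_E` has a class-bijective diagonal filler `G → Aut_B(E)` making both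
triangles commute. -/
def ClassBijectiveLiftingProperty.{u, v, w} {H : Type v} {G : Type w} [Group H] [Group G]
    (f : H →* G) : Prop :=
  ∀ (X : Type u) [MeasurableSpace X] [StandardBorelSpace X] (E : CBER X)
    (α : H →* E.Aut) (φ : G →* E.Out),
    E.proj.comp α = φ.comp f → E.ClassBijective α →
      ∃ ψ : G →* E.Aut, E.proj.comp ψ = φ ∧ ψ.comp f = α ∧ E.ClassBijective ψ

universe u

/-! By the universal property of the pushout, (1) is formal: lift the restriction of the outer
action to `H` class-bijectively to `α`, extend `α` to each `G n`, and glue. Part (2) then reduces to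
the lifting property for a morphism `f : H →* G` of finite groups.

There, a class-bijective lift extending `α` amounts to its orbit relation: an equivalence relation
containing the `α`-orbits, each class of which meets every `E`-class of an orbit of classes in
exactly one point. Given such a relation, `g` sends `x` to the unique point related to `x` in the
class assigned by `g`.

A maximal Borel family of disjoint finite transversals gives such a relation `R` on a Borel set `D`.
By maximality every orbit of classes has a class inside `D`, and travelling to that class and back
along `R` injects the space into `D` within `E`-classes. Iterating the injection yields infinitely
many disjoint copies of the complement of `D` inside `D`. A Hilbert hotel argument, run on a
transversal `Y` of the `α`-orbits so as to respect `α`, matches `Y` with `Y ∩ D`; pulling `R` back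
along this matching makes it total. -/

/-! ### Borel combinatorics along the orbits of a countable group -/

section OrbitRelations

section SetOf

variable {X : Type*} [MeasurableSpace X] {p q : X → Prop}

theorem measurableSet_and (hp : MeasurableSet {x | p x}) (hq : MeasurableSet {x | q x}) :
    MeasurableSet {x | p x ∧ q x} := hp.inter hq

theorem measurableSet_or (hp : MeasurableSet {x | p x}) (hq : MeasurableSet {x | q x}) :
    MeasurableSet {x | p x ∨ q x} := hp.union hq

theorem measurableSet_not (hp : MeasurableSet {x | p x}) : MeasurableSet {x | ¬ p x} := hp.compl

theorem measurableSet_imp (hp : MeasurableSet {x | p x}) (hq : MeasurableSet {x | q x}) :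
    MeasurableSet {x | p x → q x} := by
  simpa only [imp_iff_not_or] using measurableSet_or (measurableSet_not hp) hq

theorem measurableSet_forall {ι : Sort*} [Countable ι] {p : ι → X → Prop}
    (hp : ∀ i, MeasurableSet {x | p i x}) : MeasurableSet {x | ∀ i, p i x} := by
  convert MeasurableSet.iInter hp using 1
  ext x
  simp

theorem measurableSet_exists {ι : Sort*} [Countable ι] {p : ι → X → Prop}
    (hp : ∀ i, MeasurableSet {x | p i x}) : MeasurableSet {x | ∃ i, p i x} := by
  convert MeasurableSet.iUnion hp using 1
  ext x
  simp

end SetOf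

variable {X Γ : Type*} [MeasurableSpace X] [Group Γ] [MulAction Γ X]

/-- A relation is measurable along the orbits of `Γ` if each of its traces on the graph of an
element of `Γ` is measurable. -/
def OrbitMeasurable (Γ : Type*) [Group Γ] [MulAction Γ X] (r : X → X → Prop) : Prop :=
  ∀ γ : Γ, MeasurableSet {x | r x (γ • x)}

variable [MeasurableConstSMul Γ X]

theorem OrbitMeasurable.smul_smul {r : X → X → Prop} (hr : OrbitMeasurable Γ r) (γ δ : Γ) :
    MeasurableSet {x | r (γ • x) (δ • x)} := by
  have h : MeasurableSet ((fun x : X => γ • x) ⁻¹' {x | r x ((δ * γ⁻¹) • x)}) :=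
    (measurable_const_smul γ) (hr _)
  convert h using 1
  ext x
  simp [mul_smul]

theorem OrbitMeasurable.smul_left {r : X → X → Prop} (hr : OrbitMeasurable Γ r) (γ : Γ) :
    MeasurableSet {x | r (γ • x) x} := by
  simpa using hr.smul_smul γ 1

theorem measurableSet_smul_mem {s : Set X} (hs : MeasurableSet s) (γ : Γ) :
    MeasurableSet {x | γ • x ∈ s} :=
  (measurable_const_smul γ) hs

theorem orbitMeasurable_eq [StandardBorelSpace X] : OrbitMeasurable Γ (fun x y : X => x = y) :=
  fun γ => measurableSet_eq_fun measurable_id (measurable_const_smul γ)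

/-- The intermediate point stays in the `Γ`-orbit of `x`, so the existential is a countable union
and no projection of a Borel set is taken. -/
theorem OrbitMeasurable.comp [Countable Γ] {r s : X → X → Prop} (hr : OrbitMeasurable Γ r)
    (hs : OrbitMeasurable Γ s) (h : ∀ x y, r x y → ∃ γ : Γ, y = γ • x) :
    OrbitMeasurable Γ (fun x y => ∃ z, r x z ∧ s z y) := by
  intro γ
  have : ∀ x, (∃ z, r x z ∧ s z (γ • x)) ↔ ∃ δ : Γ, r x (δ • x) ∧ s (δ • x) (γ • x) := by
    intro x
    constructor
    · rintro ⟨z, h1, h2⟩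
      obtain ⟨δ, rfl⟩ := h _ _ h1
      exact ⟨δ, h1, h2⟩
    · rintro ⟨δ, h1, h2⟩
      exact ⟨_, h1, h2⟩
  simp only [this]
  exact measurableSet_exists fun δ => measurableSet_and (hr δ) (hs.smul_smul δ γ)

theorem OrbitMeasurable.flip {r : X → X → Prop} (hr : OrbitMeasurable Γ r) :
    OrbitMeasurable Γ (fun x y => r y x) :=
  fun γ => hr.smul_left γ

/-- A relation measurable along the orbits of a countable group can be uniformized. -/
theorem OrbitMeasurable.exists_measurable [Countable Γ] {r : X → X → Prop}
    (hr : OrbitMeasurable Γ r) :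
    ∃ τ : X → X, Measurable τ ∧ (∀ x, ∃ γ : Γ, τ x = γ • x) ∧
      ∀ x, (∃ γ : Γ, r x (γ • x)) → r x (τ x) := by
  classical
  obtain ⟨u, hu⟩ := exists_surjective_nat Γ
  -- The second disjunct makes the search for the least index terminate at points with no partner.
  let p : ℕ → X → Prop := fun n x => r x (u n • x) ∨ ∀ γ : Γ, ¬ r x (γ • x)
  have hp : ∀ n, MeasurableSet {x | p n x} := fun n =>
    measurableSet_or (hr (u n)) (measurableSet_forall fun γ => measurableSet_not (hr γ))
  have hex : ∀ x, ∃ n, p n x := by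
    intro x
    by_cases h : ∃ γ : Γ, r x (γ • x)
    · obtain ⟨γ, hγ⟩ := h
      obtain ⟨n, rfl⟩ := hu γ
      exact ⟨n, Or.inl hγ⟩
    · exact ⟨0, Or.inr (not_exists.1 h)⟩
  refine ⟨fun x => u (Nat.find (hex x)) • x,
    Measurable.find (f := fun n x => u n • x) (fun n => measurable_const_smul (u n)) hp hex,
    fun x => ⟨_, rfl⟩, fun x hx => ?_⟩
  rcases Nat.find_spec (hex x) with h | h
  · exact h
  · obtain ⟨γ, hγ⟩ := hx
    exact absurd hγ (h γ)

/-- A maximal Borel family of pairwise disjoint frames `{t i • b | i}` with admissible base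
points `b`. -/
theorem exists_maximal_disjoint_frames [StandardBorelSpace X] [Countable Γ] {ι : Type*} [Finite ι]
    [Nonempty ι] (U : (ι → Γ) → Set X) (hU : ∀ t, MeasurableSet (U t)) :
    ∃ N : (ι → Γ) → Set X, (∀ t, MeasurableSet (N t)) ∧ (∀ t, N t ⊆ U t) ∧
      (∀ t t' b b' i i', b ∈ N t → b' ∈ N t' → t i • b = t' i' • b' → t = t' ∧ b = b') ∧
      ∀ t, ∀ b ∈ U t, ∃ i t' b' i', b' ∈ N t' ∧ t i • b = t' i' • b' := by
  classical
  let _ := upgradeStandardBorel X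
  let 𝓑 := TopologicalSpace.countableBasis X
  have : Countable 𝓑 := (TopologicalSpace.countable_countableBasis X).to_subtype
  cases isEmpty_or_nonempty X with
  | inl hX =>
    exact ⟨fun _ => ∅, fun _ => MeasurableSet.empty, fun _ => Set.empty_subset _,
      fun _ _ b => hX.elim b, fun _ b => hX.elim b⟩
  | inr hX =>
  have hbasis : ∀ (x : X) (s : Set X), s.Finite → x ∉ s → ∃ B : 𝓑, x ∈ B.1 ∧ ∀ y ∈ s, y ∉ B.1 := by
    intro x s hs hx
    obtain ⟨B, hB, hxB, hBs⟩ := (TopologicalSpace.isBasis_countableBasis X).exists_subset_of_mem_open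
      (show x ∈ sᶜ from hx) hs.isClosed.isOpen_compl
    exact ⟨⟨B, hB⟩, hxB, fun y hy hyB => hBs hyB hy⟩
  have : Nonempty 𝓑 := by
    obtain ⟨x⟩ := hX
    obtain ⟨B, -⟩ := hbasis x ∅ Set.finite_empty (by simp)
    exact ⟨B⟩
  have hBm : ∀ B : 𝓑, MeasurableSet B.1 := fun B =>
    ((TopologicalSpace.isBasis_countableBasis X).isOpen B.2).measurableSet
  -- A countable colouring: two distinct base points in the same `V t B` have disjoint frames of
  -- shape `t`, since an overlap would move one to the other by some `(t j)⁻¹ * t i`, out of `B`.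
  let V : (ι → Γ) → 𝓑 → Set X := fun t B => {x | x ∈ B.1 ∧
    ∀ i j, ((t j)⁻¹ * t i) • x ≠ x → ((t j)⁻¹ * t i) • x ∉ B.1}
  have hVm : ∀ t B, MeasurableSet (V t B) := by
    intro t B
    refine measurableSet_and (hBm B) (measurableSet_forall fun i => measurableSet_forall fun j =>
      measurableSet_imp (measurableSet_not ?_) (measurableSet_not ?_))
    · exact orbitMeasurable_eq.smul_left _
    · exact measurableSet_smul_mem (hBm B) _
  have hVcov : ∀ t x, ∃ B, x ∈ V t B := by
    intro t x
    obtain ⟨B, hxB, hB⟩ := hbasis x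
      {y | y ≠ x ∧ y ∈ Set.range (fun p : ι × ι => ((t p.2)⁻¹ * t p.1) • x)}
      ((Set.finite_range _).subset fun y hy => hy.2) (by simp)
    exact ⟨B, hxB, fun i j hij => hB _ ⟨hij, ⟨(i, j), rfl⟩⟩⟩
  have hV : ∀ t B b b' i i', b ∈ V t B → b' ∈ V t B → t i • b = t i' • b' → b = b' := by
    intro t B b b' i i' hb hb' h
    by_contra hne
    have e : ((t i')⁻¹ * t i) • b = b' := by rw [mul_smul, h, inv_smul_smul]
    exact hb.2 i i' (by rw [e]; exact fun h => hne h.symm) (by rw [e]; exact hb'.1)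
  obtain ⟨u, hu⟩ := exists_surjective_nat ((ι → Γ) × 𝓑)
  -- Greedy choice: at stage `n`, add all frames of the current shape and colour that avoid the
  -- region `D` already covered. As `D` only grows, one visit to each pair is enough for maximality.
  let new : ℕ → Set X → Set X := fun n D =>
    {b | (b ∈ U (u n).1 ∧ b ∈ V (u n).1 (u n).2) ∧ ∀ j, (u n).1 j • b ∉ D}
  let D : ℕ → Set X := fun n => Nat.rec ∅
    (fun n D => D ∪ ⋃ i, {x | ((u n).1 i)⁻¹ • x ∈ new n D}) n
  have hDs : ∀ n, D (n + 1) = D n ∪ ⋃ i, {x | ((u n).1 i)⁻¹ • x ∈ new n (D n)} := fun n => rfl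
  have hnewm : ∀ n S, MeasurableSet S → MeasurableSet (new n S) := by
    intro n S hS
    exact measurableSet_and (measurableSet_and (hU _) (hVm _ _))
      (measurableSet_forall fun j => measurableSet_not (measurableSet_smul_mem hS _))
  have hDm : ∀ n, MeasurableSet (D n) := by
    intro n
    induction n with
    | zero => exact MeasurableSet.empty
    | succ n ih =>
      rw [hDs]
      exact ih.union (MeasurableSet.iUnion fun i => measurableSet_smul_mem (hnewm n _ ih) _)
  have hmono : Monotone D := monotone_nat_of_le_succ fun n => by
    rw [hDs]; exact Set.subset_union_left
  have hin : ∀ n b, b ∈ new n (D n) → ∀ i, (u n).1 i • b ∈ D (n + 1) := by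
    intro n b hb i
    rw [hDs]
    exact Or.inr (Set.mem_iUnion.2 ⟨i, by simpa using hb⟩)
  have hDex : ∀ n x, x ∈ D n → ∃ m b i, b ∈ new m (D m) ∧ x = (u m).1 i • b := by
    intro n
    induction n with
    | zero => intro x hx; exact hx.elim
    | succ n ih =>
      intro x hx
      rw [hDs] at hx
      rcases hx with hx | hx
      · exact ih x hx
      · obtain ⟨i, hi⟩ := Set.mem_iUnion.1 hx
        exact ⟨n, _, i, hi, by simp⟩
  have key : ∀ n m b b' i i', b ∈ new n (D n) → b' ∈ new m (D m) →
      (u n).1 i • b = (u m).1 i' • b' → ¬ n < m := by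
    intro n m b b' i i' hb hb' h hnm
    exact hb'.2 i' (h ▸ hmono (Nat.succ_le_of_lt hnm) (hin n b hb i))
  refine ⟨fun t => ⋃ n, {b | (u n).1 = t ∧ b ∈ new n (D n)}, fun t => ?_, fun t b hb => ?_, ?_, ?_⟩
  · refine MeasurableSet.iUnion fun n => ?_
    by_cases h : (u n).1 = t
    · simpa [h] using hnewm n _ (hDm n)
    · simp [h]
  · obtain ⟨n, rfl, h⟩ := Set.mem_iUnion.1 hb
    exact h.1.1
  · intro t t' b b' i i' hb hb' h
    obtain ⟨n, rfl, hn⟩ := Set.mem_iUnion.1 hb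
    obtain ⟨m, rfl, hm⟩ := Set.mem_iUnion.1 hb'
    obtain rfl : n = m :=
      le_antisymm (not_lt.1 (key m n b' b i' i hm hn h.symm)) (not_lt.1 (key n m b b' i i' hn hm h))
    exact ⟨rfl, hV _ _ _ _ _ _ hn.1.2 hm.1.2 h⟩
  · intro t b hb
    obtain ⟨B, hB⟩ := hVcov t b
    obtain ⟨n, hn⟩ := hu (t, B)
    rcases Classical.em (∀ j, (u n).1 j • b ∉ D n) with h | h
    · have i := Classical.arbitrary ι
      refine ⟨i, t, b, i, Set.mem_iUnion.2 ⟨n, by rw [hn], ⟨?_, h⟩⟩, rfl⟩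
      rw [hn]
      exact ⟨hb, hB⟩
    · obtain ⟨j, hj⟩ := not_forall_not.1 h
      obtain ⟨m, b', i', hb', e⟩ := hDex _ _ hj
      refine ⟨j, (u m).1, b', i', Set.mem_iUnion.2 ⟨m, rfl, hb'⟩, ?_⟩
      rw [← e, hn]

end OrbitRelations

/-! ### Partial transversals for an outer action -/

section Lifting

variable {X Γ G H : Type*} [MeasurableSpace X] [Group Γ] [MulAction Γ X] [Group G] [Group H]

/-- An action of `G` on the classes of `E`, represented by elements `T g` of a group `Γ` acting by
automorphisms of `E`, with a class-bijective lift `α` of its pullback along `f : H →* G`. -/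
structure OuterActionData (f : H →* G) (E : Setoid X) (T : G → Γ) (α : H →* Γ) : Prop where
  exists_smul : ∀ {x y}, E x y → ∃ γ : Γ, y = γ • x
  smul : ∀ (γ : Γ) {x y}, E x y → E (γ • x) (γ • y)
  orbitMeasurable : OrbitMeasurable Γ (fun x y => E x y)
  map_mul : ∀ g g' x, E (T g • T g' • x) (T (g * g') • x)
  map_hom : ∀ k x, E (α k • x) (T (f k) • x)
  classBijective : ∀ k x, E (α k • x) x → α k • x = x

/-- A partial equivalence relation `R`, invariant under `α`, whose classes are transversals for the
`E`-classes in an orbit of the outer action. -/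
structure PartialTransversal (E : Setoid X) (T : G → Γ) (α : H →* Γ) (R : X → X → Prop) :
    Prop where
  exists_smul : ∀ {x y}, R x y → ∃ γ : Γ, y = γ • x
  orbitMeasurable : OrbitMeasurable Γ R
  symm : ∀ {x y}, R x y → R y x
  trans : ∀ {x y z}, R x y → R y z → R x z
  eq_of_rel : ∀ {x y}, R x y → E x y → x = y
  exists_rel : ∀ {x}, R x x → ∀ g, ∃ y, E (T g • x) y ∧ R x y
  map : ∀ {x}, R x x → ∀ k, R x (α k • x)

namespace OuterActionData

variable {f : H →* G} {E : Setoid X} {T : G → Γ} {α : H →* Γ}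

theorem map_one (h : OuterActionData f E T α) (x : X) : E (T 1 • x) x := by
  have := h.smul (T 1)⁻¹ (h.map_mul 1 1 x)
  simpa using this

theorem map_inv (h : OuterActionData f E T α) (g : G) (x : X) : E (T g⁻¹ • T g • x) x := by
  have := h.map_mul g⁻¹ g x
  rw [inv_mul_cancel] at this
  exact E.trans this (h.map_one x)

theorem hom_smul_map (h : OuterActionData f E T α) (k : H) (g : G) (x : X) :
    E (α k • T g • x) (T (f k * g) • x) :=
  E.trans (h.map_hom _ _) (h.map_mul _ _ _)

/-- Transporting a point by `α` into a given class has only one possible result; this makes choices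
over `α`-orbits of classes coherent. -/
theorem eq_of_hom_smul (h : OuterActionData f E T α) {k k' : H} {x : X}
    (hx : E (α k • x) (α k' • x)) : α k • x = α k' • x := by
  have h1 := h.smul (α k'⁻¹) hx
  rw [← mul_smul, ← mul_smul, ← _root_.map_mul, ← _root_.map_mul, inv_mul_cancel, _root_.map_one,
    one_smul] at h1
  have h2 := congrArg (α k' • ·) (h.classBijective _ _ h1)
  simpa [← mul_smul, ← _root_.map_mul] using h2

/-- If every class in the orbit of `x` meets the complement of an `α`-invariant set `D`, then this
orbit has an `α`-invariant transversal outside `D`. -/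
theorem exists_frame (h : OuterActionData f E T α) {D : Set X}
    (hD : ∀ k x, α k • x ∈ D → x ∈ D) (x : X) (hx : ∀ g, ∃ y, E (T g • x) y ∧ y ∉ D) :
    ∃ t : G → Γ, (∀ g, E (t g • x) (T g • x)) ∧
      (∀ g g', E (t g • x) (t g' • x) → t g • x = t g' • x) ∧
      (∀ k g, α k • t g • x = t (f k * g) • x) ∧ ∀ g, t g • x ∉ D := by
  choose y hy hyD using hx
  -- Indices are identified when `α` carries one class to the other. A point outside `D` is chosen
  -- in one representative class only and transported by `α` to the rest, which makes the frame
  -- `α`-equivariant.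
  let s : Setoid G :=
    { r := fun g g' => ∃ k, E (α k • T g • x) (T g' • x)
      iseqv :=
        { refl := fun g => ⟨1, by simp⟩
          symm := by
            rintro g g' ⟨k, hk⟩
            refine ⟨k⁻¹, ?_⟩
            have := h.smul (α k⁻¹) hk
            rw [← mul_smul, ← _root_.map_mul, inv_mul_cancel, _root_.map_one, one_smul] at this
            exact E.symm this
          trans := by
            rintro g g' g'' ⟨k, hk⟩ ⟨k', hk'⟩
            refine ⟨k' * k, ?_⟩
            rw [_root_.map_mul, mul_smul]
            exact E.trans (h.smul _ hk) hk' } }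
  let rep : G → G := fun g => (Quotient.mk s g).out
  have hrep : ∀ g, ∃ k, E (α k • T (rep g) • x) (T g • x) := fun g =>
    Quotient.exact (Quotient.out_eq (Quotient.mk s g))
  have hrep_eq : ∀ {g g'} k, E (α k • T g • x) (T g' • x) → rep g = rep g' := fun k hk =>
    congrArg Quotient.out (Quotient.sound (s := s) ⟨k, hk⟩)
  choose k hk using hrep
  have hp : ∀ g, ∃ γ : Γ, γ • x = α (k g) • y (rep g) := fun g => by
    obtain ⟨γ, hγ⟩ := h.exists_smul (hy (rep g))
    exact ⟨α (k g) * γ * T (rep g), by rw [mul_smul, mul_smul, ← hγ]⟩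
  choose t ht using hp
  have htE : ∀ g, E (t g • x) (T g • x) := fun g => by
    rw [ht]
    exact E.trans (E.symm (h.smul _ (hy _))) (hk g)
  refine ⟨t, htE, fun g g' hgg' => ?_, fun l g => ?_, fun g => ?_⟩
  · have e : rep g = rep g' := hrep_eq 1 (by
      simpa using E.trans (E.symm (htE g)) (E.trans hgg' (htE g')))
    rw [ht, ht, e] at hgg' ⊢
    exact h.eq_of_hom_smul hgg'
  · have e : rep g = rep (f l * g) := hrep_eq l (h.hom_smul_map l g x)
    have h1 : E (α l • t g • x) (t (f l * g) • x) :=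
      E.trans (h.smul _ (htE g)) (E.trans (h.hom_smul_map l g x) (E.symm (htE _)))
    rw [ht, ht, e, ← mul_smul, ← _root_.map_mul] at h1 ⊢
    exact h.eq_of_hom_smul h1
  · rw [ht]
    exact fun hd => hyD _ (hD _ _ hd)

/-- There is a partial transversal whose domain contains a whole class of each orbit of classes. -/
theorem exists_partialTransversal (h : OuterActionData f E T α) [StandardBorelSpace X] [Countable Γ]
    [MeasurableConstSMul Γ X] [Finite G] [Countable H] :
    ∃ R : X → X → Prop, PartialTransversal E T α R ∧
      ∀ x, ∃ g, ∀ y, E (T g • x) y → R y y := by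
  let U : (G → Γ) → Set X := fun t => {x | (∀ g, E (t g • x) (T g • x)) ∧
      (∀ g g', E (t g • x) (t g' • x) → t g • x = t g' • x) ∧
      (∀ k g, (α k * t g) • x = t (f k * g) • x)}
  have hU : ∀ t, MeasurableSet (U t) := fun t =>
    measurableSet_and (measurableSet_forall fun g => h.orbitMeasurable.smul_smul _ _) <|
    measurableSet_and (measurableSet_forall fun g => measurableSet_forall fun g' =>
      measurableSet_imp (h.orbitMeasurable.smul_smul _ _) (orbitMeasurable_eq.smul_smul _ _)) <|
    measurableSet_forall fun k => measurableSet_forall fun g => orbitMeasurable_eq.smul_smul _ _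
  obtain ⟨N, hNm, hNU, hN, hmax⟩ := exists_maximal_disjoint_frames U hU
  let R : X → X → Prop := fun x y => ∃ t i j, ((t i)⁻¹ • x ∈ N t) ∧ y = (t j * (t i)⁻¹) • x
  have hR : ∀ {x y}, R x y ↔ ∃ t, ∃ b ∈ N t, ∃ i j, x = t i • b ∧ y = t j • b := by
    intro x y
    constructor
    · rintro ⟨t, i, j, hb, hy⟩
      exact ⟨t, _, hb, i, j, by simp, by rw [hy, mul_smul]⟩
    · rintro ⟨t, b, hb, i, j, rfl, rfl⟩
      exact ⟨t, i, j, by simpa using hb, by simp [mul_smul]⟩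
  have hRt : PartialTransversal E T α R :=
    { exists_smul := fun ⟨t, i, j, _, hy⟩ => ⟨_, hy⟩
      orbitMeasurable := fun γ => measurableSet_exists fun t => measurableSet_exists fun i =>
        measurableSet_exists fun j => measurableSet_and (measurableSet_smul_mem (hNm t) _)
          (orbitMeasurable_eq.smul_smul _ _)
      symm := fun hxy => by
        obtain ⟨t, b, hb, i, j, hx, hy⟩ := hR.1 hxy
        exact hR.2 ⟨t, b, hb, j, i, hy, hx⟩
      trans := fun hxy hyz => by
        obtain ⟨t, b, hb, i, j, hx, hy⟩ := hR.1 hxy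
        obtain ⟨t', b', hb', i', j', hy', hz⟩ := hR.1 hyz
        obtain ⟨rfl, rfl⟩ := hN _ _ _ _ _ _ hb hb' (hy.symm.trans hy')
        exact hR.2 ⟨t, b, hb, i, j', hx, hz⟩
      eq_of_rel := fun hxy hE => by
        obtain ⟨t, b, hb, i, j, rfl, rfl⟩ := hR.1 hxy
        exact (hNU t hb).2.1 _ _ hE
      exists_rel := fun hx g => by
        obtain ⟨t, b, hb, i, -, rfl, -⟩ := hR.1 hx
        refine ⟨t (g * i) • b, ?_, hR.2 ⟨t, b, hb, i, _, rfl, rfl⟩⟩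
        exact E.trans (h.smul _ ((hNU t hb).1 i))
          (E.trans (h.map_mul _ _ _) (E.symm ((hNU t hb).1 _)))
      map := fun hx k => by
        obtain ⟨t, b, hb, i, -, rfl, -⟩ := hR.1 hx
        exact hR.2 ⟨t, b, hb, i, f k * i, rfl, by rw [← (hNU t hb).2.2, mul_smul]⟩ }
  refine ⟨R, hRt, fun x => ?_⟩
  by_contra! hx
  -- If no class of the orbit lies inside the domain, a whole admissible frame fits outside it,
  -- against maximality.
  obtain ⟨t, ht1, ht2, ht3, ht4⟩ := h.exists_frame (D := {y | R y y}) (fun k y hy => by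
    have h1 : R _ _ := hRt.map hy k⁻¹
    rw [← mul_smul, ← _root_.map_mul, inv_mul_cancel, _root_.map_one, one_smul] at h1
    exact hRt.trans (hRt.symm h1) h1) x hx
  obtain ⟨i, t', b', i', hb', e⟩ := hmax t x ⟨ht1, ht2, fun k g => by rw [mul_smul, ht3]⟩
  exact ht4 i (hR.2 ⟨t', b', hb', i', i', e, e⟩)

end OuterActionData

end Lifting

/-! ### Absorbing infinitely many disjoint copies -/

section Absorption

variable {X Γ : Type*} [MeasurableSpace X] [Group Γ] [MulAction Γ X]

/-- The set `B` contains infinitely many pairwise disjoint copies of `A`, inside the classes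
of `L`. -/
def AbsorbsCopies (L : Setoid X) (A B : Set X) : Prop :=
  ∃ e : ℕ → X → X, (∀ n, Measurable (e n)) ∧ (∀ n, ∀ a ∈ A, L a (e n a)) ∧
    (∀ n, ∀ a ∈ A, e n a ∈ B) ∧
    ∀ n m, ∀ a ∈ A, ∀ b ∈ A, e n a = e m b → n = m ∧ a = b

variable {L : Setoid X}

theorem AbsorbsCopies.comp {A B C : Set X} (h : AbsorbsCopies L A B) {τ : X → X} (hτ : Measurable τ)
    (hL : ∀ b ∈ B, L b (τ b)) (hC : ∀ b ∈ B, τ b ∈ C) (hinj : Set.InjOn τ B) :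
    AbsorbsCopies L A C := by
  obtain ⟨e, he, heL, heB, hei⟩ := h
  exact ⟨fun n => τ ∘ e n, fun n => hτ.comp (he n),
    fun n a ha => L.trans (heL n a ha) (hL _ (heB n a ha)),
    fun n a ha => hC _ (heB n a ha), fun n m a ha b hb hab =>
      hei n m a ha b hb (hinj (heB n a ha) (heB m b hb) hab)⟩

theorem AbsorbsCopies.subseq {A B : Set X} {e : ℕ → X → X} (he : ∀ n, Measurable (e n))
    (heL : ∀ n, ∀ a ∈ A, L a (e n a)) (hei : ∀ n m, ∀ a ∈ A, ∀ b ∈ A, e n a = e m b → n = m ∧ a = b)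
    {A' : Set X} (hA' : A' ⊆ A) {u : ℕ → ℕ} (hu : u.Injective) (hB : ∀ n, ∀ a ∈ A', e (u n) a ∈ B) :
    AbsorbsCopies L A' B :=
  ⟨fun n => e (u n), fun n => he _, fun n a ha => heL _ a (hA' ha), hB,
    fun n m a ha b hb hab => by
      obtain ⟨h1, h2⟩ := hei _ _ a (hA' ha) b (hA' hb) hab
      exact ⟨hu h1, h2⟩⟩

-- Invariance of `Z` keeps the copies of the two parts of `A` in different classes of `L`, hence
-- disjoint.
open Classical in
theorem AbsorbsCopies.glue {A B Z : Set X} (hZ : MeasurableSet Z)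
    (hinv : ∀ {x y}, L x y → x ∈ Z → y ∈ Z)
    (h1 : AbsorbsCopies L (A ∩ Z) B) (h2 : AbsorbsCopies L (A \ Z) B) : AbsorbsCopies L A B := by
  obtain ⟨e, he, heL, heB, hei⟩ := h1
  obtain ⟨e', he', heL', heB', hei'⟩ := h2
  have hsep : ∀ {n m a b}, a ∈ A ∩ Z → b ∈ A \ Z → e n a ≠ e' m b := by
    intro n m a b ha hb hab
    refine hb.2 (hinv (L.symm (heL' m b hb)) ?_)
    rw [← hab]
    exact hinv (heL n a ha) ha.2
  refine ⟨fun n => Z.piecewise (e n) (e' n), fun n => (he n).piecewise hZ (he' n), ?_, ?_, ?_⟩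
  · intro n a ha
    by_cases hz : a ∈ Z
    · simpa [hz] using heL n a ⟨ha, hz⟩
    · simpa [hz] using heL' n a ⟨ha, hz⟩
  · intro n a ha
    by_cases hz : a ∈ Z
    · simpa [hz] using heB n a ⟨ha, hz⟩
    · simpa [hz] using heB' n a ⟨ha, hz⟩
  · intro n m a ha b hb hab
    by_cases hz : a ∈ Z <;> by_cases hz' : b ∈ Z <;> simp only [hz, hz', Set.piecewise_eq_of_mem,
      Set.piecewise_eq_of_notMem, not_false_eq_true] at hab
    · exact hei n m a ⟨ha, hz⟩ b ⟨hb, hz'⟩ hab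
    · exact absurd hab (hsep ⟨ha, hz⟩ ⟨hb, hz'⟩)
    · exact absurd hab.symm (hsep ⟨hb, hz'⟩ ⟨ha, hz⟩)
    · exact hei' n m a ⟨ha, hz⟩ b ⟨hb, hz'⟩ hab

variable [MeasurableConstSMul Γ X] [Countable Γ] [StandardBorelSpace X]

/-- Comparability: up to a partition into two invariant sets, one of two disjoint sets
injects into the other. -/
theorem exists_comparison (hL : ∀ {x y}, L x y → ∃ γ : Γ, y = γ • x)
    (hLm : OrbitMeasurable Γ (fun x y => L x y)) {A B : Set X} (hA : MeasurableSet A)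
    (hB : MeasurableSet B) (hAB : Disjoint A B) :
    ∃ Z : Set X, MeasurableSet Z ∧ (∀ {x y}, L x y → x ∈ Z → y ∈ Z) ∧
      (∃ τ : X → X, Measurable τ ∧ (∀ a ∈ A ∩ Z, L a (τ a) ∧ τ a ∈ B) ∧ Set.InjOn τ (A ∩ Z)) ∧
      ∃ τ : X → X, Measurable τ ∧ (∀ b ∈ B \ Z, L b (τ b) ∧ τ b ∈ A) ∧ Set.InjOn τ (B \ Z) := by
  -- Frames indexed by `Bool` are pairs to be matched, so a maximal disjoint family is a maximal
  -- matching `M` of `A` with `B`.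
  let U : (Bool → Γ) → Set X := fun t =>
    {x | t false • x ∈ A ∧ t true • x ∈ B ∧ L (t false • x) (t true • x)}
  obtain ⟨N, hNm, hNU, hN, hmax⟩ := exists_maximal_disjoint_frames U fun t =>
    measurableSet_and (measurableSet_smul_mem hA _) <|
      measurableSet_and (measurableSet_smul_mem hB _) (hLm.smul_smul _ _)
  let M : X → X → Prop := fun x y =>
    ∃ t, (t false)⁻¹ • x ∈ N t ∧ y = (t true * (t false)⁻¹) • x
  have hM : ∀ {x y}, M x y ↔ ∃ t, ∃ b ∈ N t, x = t false • b ∧ y = t true • b := by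
    intro x y
    constructor
    · rintro ⟨t, hb, hy⟩
      exact ⟨t, _, hb, by simp, by rw [hy, mul_smul]⟩
    · rintro ⟨t, b, hb, rfl, rfl⟩
      exact ⟨t, by simpa using hb, by simp [mul_smul]⟩
  have hMm : OrbitMeasurable Γ M := fun γ => measurableSet_exists fun t =>
    measurableSet_and (measurableSet_smul_mem (hNm t) _) (orbitMeasurable_eq.smul_smul _ _)
  have hMU : ∀ {x y}, M x y → x ∈ A ∧ y ∈ B ∧ L x y := fun hxy => by
    obtain ⟨t, b, hb, rfl, rfl⟩ := hM.1 hxy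
    exact hNU t hb
  have hMr : ∀ {x y y'}, M x y → M x y' → y = y' := fun h1 h2 => by
    obtain ⟨t, b, hb, rfl, rfl⟩ := hM.1 h1
    obtain ⟨t', b', hb', h, rfl⟩ := hM.1 h2
    obtain ⟨rfl, rfl⟩ := hN _ _ _ _ _ _ hb hb' h
    rfl
  have hMl : ∀ {x x' y}, M x y → M x' y → x = x' := fun h1 h2 => by
    obtain ⟨t, b, hb, rfl, rfl⟩ := hM.1 h1
    obtain ⟨t', b', hb', rfl, h⟩ := hM.1 h2
    obtain ⟨rfl, rfl⟩ := hN _ _ _ _ _ _ hb hb' h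
    rfl
  have hMmax : ∀ {x y}, x ∈ A → y ∈ B → L x y → (∃ z, M x z) ∨ ∃ z, M z y := by
    intro x y hx hy hxy
    obtain ⟨γ, rfl⟩ := hL hxy
    obtain ⟨i, t, b, j, hb, e⟩ := hmax (fun i => cond i γ 1) x ⟨by simpa, by simpa, by simpa⟩
    have hb' := hNU t hb
    cases i <;> cases j <;> simp only [cond_true, cond_false, one_smul] at e
    · exact Or.inl ⟨_, hM.2 ⟨t, b, hb, e, rfl⟩⟩
    · exact absurd (e ▸ hb'.2.1 : x ∈ B) (Set.disjoint_left.1 hAB hx)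
    · exact absurd hy (Set.disjoint_left.1 hAB (e ▸ hb'.1))
    · exact Or.inr ⟨_, hM.2 ⟨t, b, hb, rfl, e⟩⟩
  have horb : ∀ {x y}, M x y → ∃ γ : Γ, y = γ • x := fun h => hL (hMU h).2.2
  -- The classes in which all of `A` is matched. In any other class, an unmatched point of `A`
  -- forces all of `B` to be matched.
  let Z : Set X := {x | ∀ γ : Γ, L x (γ • x) → γ • x ∈ A → ∃ δ : Γ, M (γ • x) (δ • x)}
  have hZ : ∀ {x}, x ∈ Z ↔ ∀ y, L x y → y ∈ A → ∃ z, M y z := by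
    intro x
    constructor
    · intro hx y hxy hy
      obtain ⟨γ, rfl⟩ := hL hxy
      obtain ⟨δ, hδ⟩ := hx γ hxy hy
      exact ⟨_, hδ⟩
    · intro hx γ hxy hy
      obtain ⟨z, hz⟩ := hx _ hxy hy
      obtain ⟨δ, rfl⟩ := horb hz
      exact ⟨δ * γ, by rwa [mul_smul]⟩
  refine ⟨Z, ?_, ?_, ?_, ?_⟩
  · exact measurableSet_forall fun γ => measurableSet_imp (hLm γ) <| measurableSet_imp
      (measurableSet_smul_mem hA γ) <| measurableSet_exists fun δ => hMm.smul_smul _ _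
  · intro x y hxy hx
    exact hZ.2 fun z hyz hz => hZ.1 hx z (L.trans hxy hyz) hz
  · obtain ⟨τ, hτ, -, hτM⟩ := hMm.exists_measurable
    have hτ' : ∀ a ∈ A ∩ Z, M a (τ a) := fun a ha => by
      obtain ⟨z, hz⟩ := hZ.1 ha.2 a (L.refl a) ha.1
      obtain ⟨γ, rfl⟩ := horb hz
      exact hτM a ⟨γ, hz⟩
    refine ⟨τ, hτ, fun a ha => ⟨(hMU (hτ' a ha)).2.2, (hMU (hτ' a ha)).2.1⟩, ?_⟩
    intro a ha b hb hab
    exact hMl (hτ' a ha) (hab ▸ hτ' b hb)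
  · obtain ⟨τ, hτ, -, hτM⟩ := hMm.flip.exists_measurable
    have hτ' : ∀ b ∈ B \ Z, M (τ b) b := fun b hb => by
      have hbZ : ¬ ∀ y, L b y → y ∈ A → ∃ z, M y z := fun h => hb.2 (hZ.2 h)
      push Not at hbZ
      obtain ⟨y, hby, hy, hyz⟩ := hbZ
      rcases hMmax hy hb.1 (L.symm hby) with ⟨z, hz⟩ | ⟨z, hz⟩
      · exact absurd hz (hyz z)
      · obtain ⟨γ, rfl⟩ := hL (L.symm (hMU hz).2.2)
        exact hτM b ⟨γ, hz⟩
    refine ⟨τ, hτ, fun b hb => ⟨L.symm (hMU (hτ' b hb)).2.2, (hMU (hτ' b hb)).1⟩, ?_⟩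
    intro a ha b hb hab
    exact hMr (hτ' a ha) (hab ▸ hτ' b hb)

open Classical in
/-- If a union absorbs `A`, then, up to a partition into two invariant sets, one of its two parts
absorbs `A`. -/
theorem AbsorbsCopies.exists_split (hL : ∀ {x y}, L x y → ∃ γ : Γ, y = γ • x)
    (hLm : OrbitMeasurable Γ (fun x y => L x y)) {A B C : Set X} (hA : MeasurableSet A)
    (hB : MeasurableSet B) (hC : MeasurableSet C) (h : AbsorbsCopies L A (B ∪ C)) :
    ∃ Z : Set X, MeasurableSet Z ∧ (∀ {x y}, L x y → x ∈ Z → y ∈ Z) ∧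
      AbsorbsCopies L (A ∩ Z) B ∧ AbsorbsCopies L (A \ Z) C := by
  obtain ⟨e, he, heL, heB, hei⟩ := h
  have him : ∀ n, MeasurableSet (e n '' A) := fun n =>
    hA.image_of_measurable_injOn (he n) fun a ha b hb hab => (hei n n a ha b hb hab).2
  let P : Set X := ⋃ n, e (2 * n) '' A
  let Q : Set X := ⋃ n, e (2 * n + 1) '' A
  have hP : ∀ n, ∀ a ∈ A, e (2 * n) a ∈ P := fun n a ha => Set.mem_iUnion.2 ⟨n, a, ha, rfl⟩
  have hQ : ∀ n, ∀ a ∈ A, e (2 * n + 1) a ∈ Q := fun n a ha => Set.mem_iUnion.2 ⟨n, a, ha, rfl⟩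
  have hPQ : Disjoint P Q := by
    rw [Set.disjoint_left]
    intro x hx hx'
    obtain ⟨n, a, ha, rfl⟩ := Set.mem_iUnion.1 hx
    obtain ⟨m, b, hb, hab⟩ := Set.mem_iUnion.1 hx'
    have := (hei _ _ b hb a ha hab).1
    omega
  have hPm : MeasurableSet P := MeasurableSet.iUnion fun n => him _
  have hQm : MeasurableSet Q := MeasurableSet.iUnion fun n => him _
  -- On `Z`, the even copies keep their part in `B` and move the rest into `B ∩ Q`, which is free
  -- because `Q` holds the odd copies. Off `Z`, the odd copies symmetrically move their part in `B`
  -- into `C ∩ P`.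
  obtain ⟨Z, hZm, hZ, ⟨τ, hτ, hτB, hτi⟩, ⟨σ, hσ, hσC, hσi⟩⟩ := exists_comparison hL hLm
    (A := (C \ B) ∩ P) (B := B ∩ Q) ((hC.diff hB).inter hPm) (hB.inter hQm)
    (hPQ.mono Set.inter_subset_right Set.inter_subset_right)
  have hZc : ∀ {x y}, L x y → x ∉ Z → y ∉ Z := fun hxy hx hy => hx (hZ (L.symm hxy) hy)
  refine ⟨Z, hZm, hZ, ?_, ?_⟩
  · have h1 : AbsorbsCopies L (A ∩ Z) ((B ∪ C) ∩ P ∩ Z) :=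
      AbsorbsCopies.subseq he heL hei Set.inter_subset_left (u := fun n => 2 * n)
        (fun n m hnm => by simpa using hnm)
        fun n a ha => ⟨⟨heB _ a ha.1, hP n a ha.1⟩, hZ (heL _ a ha.1) ha.2⟩
    have hcase : ∀ b ∈ (B ∪ C) ∩ P ∩ Z, b ∉ B → b ∈ (C \ B) ∩ P ∩ Z := fun b hb hbB =>
      ⟨⟨⟨hb.1.1.resolve_left hbB, hbB⟩, hb.1.2⟩, hb.2⟩
    refine h1.comp (τ := B.piecewise id τ) (measurable_id.piecewise hB hτ) ?_ ?_ ?_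
    · intro b hb
      by_cases hbB : b ∈ B
      · simp [hbB]
      · simpa [hbB] using (hτB b (hcase b hb hbB)).1
    · intro b hb
      by_cases hbB : b ∈ B
      · simp [hbB]
      · simpa [hbB] using (hτB b (hcase b hb hbB)).2.1
    · intro b hb c hc hbc
      by_cases hbB : b ∈ B <;> by_cases hcB : c ∈ B <;> simp only [hbB, hcB,
        Set.piecewise_eq_of_mem, Set.piecewise_eq_of_notMem, not_false_eq_true, id] at hbc
      · exact hbc
      · exact absurd (hbc ▸ (hτB c (hcase c hc hcB)).2.2) (Set.disjoint_left.1 hPQ hb.1.2)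
      · exact absurd (hbc ▸ (hτB b (hcase b hb hbB)).2.2) (Set.disjoint_left.1 hPQ hc.1.2)
      · exact hτi (hcase b hb hbB) (hcase c hc hcB) hbc
  · have h1 : AbsorbsCopies L (A \ Z) (((B ∪ C) ∩ Q) \ Z) :=
      AbsorbsCopies.subseq he heL hei Set.sdiff_subset (u := fun n => 2 * n + 1)
        (fun n m hnm => by simpa using hnm)
        fun n a ha => ⟨⟨heB _ a ha.1, hQ n a ha.1⟩, hZc (heL _ a ha.1) ha.2⟩
    refine h1.comp (τ := B.piecewise σ id) (hσ.piecewise hB measurable_id) ?_ ?_ ?_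
    · intro b hb
      by_cases hbB : b ∈ B
      · simpa [hbB] using (hσC b ⟨⟨hbB, hb.1.2⟩, hb.2⟩).1
      · simp [hbB]
    · intro b hb
      by_cases hbB : b ∈ B
      · simpa [hbB] using (hσC b ⟨⟨hbB, hb.1.2⟩, hb.2⟩).2.1.1
      · simpa [hbB] using hb.1.1.resolve_left hbB
    · intro b hb c hc hbc
      by_cases hbB : b ∈ B <;> by_cases hcB : c ∈ B <;> simp only [hbB, hcB,
        Set.piecewise_eq_of_mem, Set.piecewise_eq_of_notMem, not_false_eq_true, id] at hbc
      · exact hσi ⟨⟨hbB, hb.1.2⟩, hb.2⟩ ⟨⟨hcB, hc.1.2⟩, hc.2⟩ hbc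
      · exact absurd hc.1.2 (Set.disjoint_left.1 hPQ (hbc ▸ (hσC b ⟨⟨hbB, hb.1.2⟩, hb.2⟩).2.2))
      · exact absurd hb.1.2 (Set.disjoint_left.1 hPQ (hbc ▸ (hσC c ⟨⟨hcB, hc.1.2⟩, hc.2⟩).2.2))
      · exact hbc

/-- If finitely many sets, each of which injects into `B`, together absorb `A`, then `B`
absorbs `A`. -/
theorem AbsorbsCopies.of_iUnion {κ : Type*} (hL : ∀ {x y}, L x y → ∃ γ : Γ, y = γ • x)
    (hLm : OrbitMeasurable Γ (fun x y => L x y)) {B : Set X} {C : κ → Set X}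
    (hC : ∀ k, MeasurableSet (C k))
    (hCB : ∀ k, ∃ τ : X → X, Measurable τ ∧ (∀ c ∈ C k, L c (τ c)) ∧ (∀ c ∈ C k, τ c ∈ B) ∧
      Set.InjOn τ (C k)) (s : Finset κ) :
    ∀ {A : Set X}, MeasurableSet A → AbsorbsCopies L A (⋃ k ∈ s, C k) → AbsorbsCopies L A B := by
  classical
  induction s using Finset.induction_on with
  | empty =>
    rintro A - ⟨e, he, heL, heB, hei⟩
    have : ∀ n, ∀ a ∈ A, e n a ∈ B := fun n a ha => by simpa using heB n a ha
    exact ⟨e, he, heL, this, hei⟩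
  | insert k s _ ih =>
    intro A hA h
    rw [Finset.set_biUnion_insert] at h
    obtain ⟨Z, hZm, hZ, h1, h2⟩ := h.exists_split hL hLm hA (hC k)
      (Finset.measurableSet_biUnion s fun i _ => hC i)
    obtain ⟨τ, hτ, hτL, hτB, hτi⟩ := hCB k
    exact AbsorbsCopies.glue hZm hZ (h1.comp hτ hτL hτB hτi) (ih (hA.diff hZm) h2)

end Absorption

/-! ### From a partial transversal to a total one -/

section TotalTransversal

/-- If `B ⊆ Y` absorbs the complement of `B` in `Y`, then `Y` and `B` are in bijection, inside the
classes of `L`. -/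
theorem AbsorbsCopies.exists_bijection {X Γ : Type*} [MeasurableSpace X] [Group Γ] [MulAction Γ X]
    [MeasurableConstSMul Γ X] [Countable Γ] [StandardBorelSpace X] {L : Setoid X}
    (hL : ∀ {x y}, L x y → ∃ γ : Γ, y = γ • x) {Y B : Set X} (hY : MeasurableSet Y)
    (hB : MeasurableSet B) (hBY : B ⊆ Y) (h : AbsorbsCopies L (Y \ B) B) :
    ∃ r : X → X → Prop, OrbitMeasurable Γ r ∧ (∀ {x z}, r x z → x ∈ Y ∧ z ∈ B ∧ L x z) ∧
      (∀ x ∈ Y, ∃ z, r x z) ∧ (∀ z ∈ B, ∃ x, r x z) ∧ (∀ {x z z'}, r x z → r x z' → z = z') ∧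
      ∀ {x x' z}, r x z → r x' z → x = x' := by
  classical
  obtain ⟨e, he, heL, heB, hei⟩ := h
  -- Hilbert's hotel: `Y \ B` goes to copy `0`, copy `n` to copy `n + 1`, and all other points stay
  -- fixed.
  let r : X → X → Prop := fun x z => (x ∈ Y \ B ∧ z = e 0 x) ∨
    (∃ n, ∃ a ∈ Y \ B, x = e n a ∧ z = e (n + 1) a) ∨
    (x ∈ B ∧ (∀ n, ∀ a ∈ Y \ B, x ≠ e n a) ∧ z = x)
  have hYB : MeasurableSet (Y \ B) := hY.diff hB
  refine ⟨r, ?_, ?_, ?_, ?_, ?_, ?_⟩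
  · intro γ
    have hex : ∀ {p : X → X → Prop} {q : X → Prop}, (∀ {a x}, a ∈ Y \ B → p a x → L a x) →
        (∀ x, q x ↔ ∃ a ∈ Y \ B, p a x) →
        (∀ δ : Γ, MeasurableSet {x | p (δ • x) x}) → MeasurableSet {x | q x} := by
      intro p q hp hq hm
      have : ∀ x, q x ↔ ∃ δ : Γ, δ • x ∈ Y \ B ∧ p (δ • x) x := fun x => by
        rw [hq]
        constructor
        · rintro ⟨a, ha, hax⟩
          obtain ⟨δ, rfl⟩ := hL (L.symm (hp ha hax))
          exact ⟨δ, ha, hax⟩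
        · rintro ⟨δ, h1, h2⟩
          exact ⟨_, h1, h2⟩
      simp only [this]
      exact measurableSet_exists fun δ => measurableSet_and (measurableSet_smul_mem hYB δ) (hm δ)
    refine measurableSet_or (measurableSet_and hYB ?_) <| measurableSet_or
      (measurableSet_exists fun n => ?_) (measurableSet_and hB (measurableSet_and ?_ ?_))
    · exact measurableSet_eq_fun (measurable_const_smul γ) (he 0)
    · refine hex (p := fun a x => x = e n a ∧ γ • x = e (n + 1) a)
        (fun ha hx => hx.1 ▸ heL _ _ ha) (fun x => Iff.rfl) fun δ => measurableSet_and ?_ ?_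
      · exact measurableSet_eq_fun measurable_id ((he n).comp (measurable_const_smul δ))
      · exact measurableSet_eq_fun (measurable_const_smul γ)
          ((he (n + 1)).comp (measurable_const_smul δ))
    · refine measurableSet_forall fun n => ?_
      have h1 : MeasurableSet {x | ∃ a ∈ Y \ B, x = e n a} :=
        hex (p := fun a x => x = e n a) (fun ha hx => hx ▸ heL _ _ ha) (fun x => Iff.rfl) fun δ =>
          measurableSet_eq_fun measurable_id ((he n).comp (measurable_const_smul δ))
      simpa using measurableSet_not h1
    · exact measurableSet_eq_fun (measurable_const_smul γ) measurable_id
  · rintro x z (⟨hx, rfl⟩ | ⟨n, a, ha, rfl, rfl⟩ | ⟨hx, -, rfl⟩)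
    · exact ⟨hx.1, heB 0 x hx, heL 0 x hx⟩
    · exact ⟨hBY (heB n a ha), heB _ a ha, L.trans (L.symm (heL n a ha)) (heL _ a ha)⟩
    · exact ⟨hBY hx, hx, L.refl _⟩
  · intro x hx
    by_cases hxB : x ∈ B
    · by_cases hex : ∃ n, ∃ a ∈ Y \ B, x = e n a
      · obtain ⟨n, a, ha, e⟩ := hex
        exact ⟨_, Or.inr (Or.inl ⟨n, a, ha, e, rfl⟩)⟩
      · push Not at hex
        exact ⟨x, Or.inr (Or.inr ⟨hxB, hex, rfl⟩)⟩
    · exact ⟨_, Or.inl ⟨⟨hx, hxB⟩, rfl⟩⟩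
  · intro z hz
    by_cases hex : ∃ n, ∃ a ∈ Y \ B, z = e n a
    · obtain ⟨n, a, ha, e⟩ := hex
      cases n with
      | zero => exact ⟨a, Or.inl ⟨ha, e⟩⟩
      | succ n => exact ⟨_, Or.inr (Or.inl ⟨n, a, ha, rfl, e⟩)⟩
    · push Not at hex
      exact ⟨z, Or.inr (Or.inr ⟨hz, hex, rfl⟩)⟩
  · rintro x z z' (⟨hx, rfl⟩ | ⟨n, a, ha, rfl, rfl⟩ | ⟨hx, hne, rfl⟩)
      (⟨hx', rfl⟩ | ⟨m, b, hb, hab, rfl⟩ | ⟨hx', hne', rfl⟩)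
    · rfl
    · exact absurd (hab ▸ heB m b hb) hx.2
    · exact absurd hx' hx.2
    · exact absurd (heB n a ha) hx'.2
    · obtain ⟨rfl, rfl⟩ := hei _ _ a ha b hb hab
      rfl
    · exact absurd rfl (hne' n a ha)
    · exact absurd hx hx'.2
    · exact absurd hab (hne m b hb)
    · rfl
  · rintro x x' z (⟨hx, rfl⟩ | ⟨n, a, ha, rfl, rfl⟩ | ⟨hx, hne, rfl⟩)
      (⟨hx', hab⟩ | ⟨m, b, hb, rfl, hab⟩ | ⟨hx', hne', hab⟩)
    · exact (hei _ _ x hx x' hx' hab).2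
    · exact absurd (hei _ _ x hx b hb hab).1 (by omega)
    · exact absurd hab.symm (hne' 0 x hx)
    · exact absurd (hei _ _ a ha x' hx' hab).1 (by omega)
    · obtain ⟨h1, rfl⟩ := hei _ _ a ha b hb hab
      obtain rfl : n = m := by omega
      rfl
    · exact absurd hab.symm (hne' _ a ha)
    · exact absurd hab (hne 0 x' hx')
    · exact absurd hab (hne _ b hb)
    · exact hab

namespace OuterActionData

variable {X Γ G H : Type*} [MeasurableSpace X] [Group Γ] [MulAction Γ X] [Group G] [Group H]
  {f : H →* G} {E : Setoid X} {T : G → Γ} {α : H →* Γ}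

/-- The equivalence relation generated by `E` and `α`. -/
def joinSetoid (h : OuterActionData f E T α) : Setoid X where
  r x y := ∃ k, E (α k • x) y
  iseqv :=
    { refl := fun x => ⟨1, by simp⟩
      symm := by
        rintro x y ⟨k, hk⟩
        have := h.smul (α k⁻¹) hk
        rw [← mul_smul, ← _root_.map_mul, inv_mul_cancel, _root_.map_one, one_smul] at this
        exact ⟨k⁻¹, E.symm this⟩
      trans := by
        rintro x y z ⟨k, hk⟩ ⟨k', hk'⟩
        refine ⟨k' * k, ?_⟩
        rw [_root_.map_mul, mul_smul]
        exact E.trans (h.smul _ hk) hk' }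

variable [Countable Γ] [MeasurableConstSMul Γ X]

/-- The space embeds, inside the classes of `E`, into the domain of a partial transversal which
contains a whole class of each orbit of classes. -/
theorem exists_embedding (h : OuterActionData f E T α) [Finite G] {R : X → X → Prop}
    (hR : PartialTransversal E T α R) (hfull : ∀ x, ∃ g, ∀ y, E (T g • x) y → R y y) :
    ∃ S : X → X, Measurable S ∧ (∀ x, E x (S x)) ∧ (∀ x, R (S x) (S x)) ∧ S.Injective := by
  classical
  -- The indices of classes lying wholly in the domain of `R`. This set depends only on the
  -- `E`-class of `x`, so a choice `c` from it is constant on classes, as injectivity of `S`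
  -- requires.
  let good : X → Set G := fun x => {g | ∀ y, E (T g • x) y → R y y}
  have hgood : ∀ {x y}, E x y → good x = good y := fun {x y} hxy => Set.ext fun g =>
    ⟨fun hg z hz => hg z (E.trans (h.smul _ hxy) hz),
      fun hg z hz => hg z (E.trans (h.smul _ (E.symm hxy)) hz)⟩
  have hgood_iff : ∀ x g, g ∈ good x ↔ ∀ γ : Γ, E (T g • x) (γ • x) → R (γ • x) (γ • x) := by
    refine fun x g => ⟨fun hg γ hγ => hg _ hγ, fun hg y hy => ?_⟩
    obtain ⟨γ, rfl⟩ := h.exists_smul hy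
    rw [← mul_smul] at hy ⊢
    exact hg _ hy
  have hgoodm : ∀ g, MeasurableSet {x | g ∈ good x} := fun g => by
    simp only [hgood_iff]
    exact measurableSet_forall fun γ => measurableSet_imp (h.orbitMeasurable.smul_smul _ _)
      (hR.orbitMeasurable.smul_smul _ _)
  have hgoodm' : ∀ s, MeasurableSet {x | good x = s} := fun s => by
    simp only [Set.ext_iff]
    refine measurableSet_forall fun g => ?_
    by_cases hg : g ∈ s
    · simpa [hg] using hgoodm g
    · simpa [hg] using measurableSet_not (hgoodm g)
  obtain ⟨c, hc⟩ : ∃ c : Set G → G, ∀ s : Set G, s.Nonempty → c s ∈ s := by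
    refine ⟨fun s => if hs : s.Nonempty then hs.some else 1, fun s hs => ?_⟩
    simpa [hs] using hs.some_mem
  -- `S x` is the partner under `R`, in the class of `x`, of the translate of `x` into its good
  -- class.
  have hs : OrbitMeasurable Γ (fun x y => ∃ s, good x = s ∧ R (T (c s) • x) y ∧ E x y) := fun γ =>
    measurableSet_exists fun s => measurableSet_and (hgoodm' s) <| measurableSet_and
      (hR.orbitMeasurable.smul_smul _ _) (h.orbitMeasurable γ)
  obtain ⟨S, hS, -, hSr⟩ := hs.exists_measurable
  have hS' : ∀ x, R (T (c (good x)) • x) (S x) ∧ E x (S x) := fun x => by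
    have hg : c (good x) ∈ good x := hc _ (hfull x)
    obtain ⟨y, hy, hRy⟩ := hR.exists_rel (hg _ (E.refl _)) (c (good x))⁻¹
    have hxy : E x y := E.trans (E.symm (h.map_inv _ x)) hy
    obtain ⟨γ, rfl⟩ := h.exists_smul hxy
    obtain ⟨s, rfl, h1, h2⟩ := hSr x ⟨γ, _, rfl, hRy, hxy⟩
    exact ⟨h1, h2⟩
  refine ⟨S, hS, fun x => (hS' x).2, fun x => hR.trans (hR.symm (hS' x).1) (hS' x).1, ?_⟩
  intro x y hxy
  have hE : E x y := E.trans (hS' x).2 (hxy ▸ E.symm (hS' y).2)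
  have h1 := (hS' x).1
  rw [hxy, hgood hE] at h1
  exact MulAction.injective _ (hR.eq_of_rel (hR.trans h1 (hR.symm (hS' y).1)) (h.smul _ hE))

variable [StandardBorelSpace X]

/-- The orbits of an action of a finite group have a measurable transversal. -/
theorem exists_section [Finite H] (α : H →* Γ) :
    ∃ Y : Set X, MeasurableSet Y ∧ (∀ x, ∃ k, α k • x ∈ Y) ∧
      ∀ k, ∀ y ∈ Y, α k • y ∈ Y → α k • y = y := by
  -- With `α` as the only admissible shape, frames are exactly the `α`-orbits.
  obtain ⟨N, hNm, hNU, hN, hmax⟩ := exists_maximal_disjoint_frames (X := X)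
    (fun t : H → Γ => {_x : X | t = α}) fun t => MeasurableSet.const _
  refine ⟨N α, hNm α, fun x => ?_, fun k y hy hky => ?_⟩
  · obtain ⟨i, t, b, j, hb, e⟩ := hmax α x rfl
    obtain rfl : t = α := hNU t hb
    refine ⟨j⁻¹ * i, ?_⟩
    rw [_root_.map_mul, mul_smul, e, ← mul_smul, ← _root_.map_mul, inv_mul_cancel, _root_.map_one,
      one_smul]
    exact hb
  · exact (hN α α _ _ 1 k hky hy (by simp)).2

/-- There is a partial transversal with full domain. -/
theorem exists_total_transversal (h : OuterActionData f E T α) [Finite G] [Finite H] :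
    ∃ R : X → X → Prop, PartialTransversal E T α R ∧ ∀ x, R x x := by
  classical
  obtain ⟨R, hR, hfull⟩ := h.exists_partialTransversal
  obtain ⟨S, hS, hSE, hSR, hSi⟩ := h.exists_embedding hR hfull
  obtain ⟨Y, hY, hYex, hYuniq⟩ := exists_section (X := X) α
  let L := h.joinSetoid
  have hEL : ∀ {x y}, E x y → L x y := fun hxy => ⟨1, by simpa using hxy⟩
  have hαL : ∀ k x, L x (α k • x) := fun k x => ⟨k, E.refl _⟩
  have hL : ∀ {x y}, L x y → ∃ γ : Γ, y = γ • x := by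
    rintro x y ⟨k, hk⟩
    obtain ⟨γ, rfl⟩ := h.exists_smul hk
    exact ⟨γ * α k, by rw [mul_smul]⟩
  have hLm : OrbitMeasurable Γ (fun x y => L x y) := fun γ =>
    measurableSet_exists fun k => h.orbitMeasurable.smul_smul _ _
  let D : Set X := {x | R x x}
  have hD : MeasurableSet D := by
    have := hR.orbitMeasurable 1
    simp only [one_smul] at this
    exact this
  have hDα : ∀ {x}, x ∈ D → ∀ k, α k • x ∈ D := fun hx k =>
    hR.trans (hR.symm (hR.map hx k)) (hR.map hx k)
  have hSn : ∀ n x, L x (S^[n] x) := by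
    intro n
    induction n with
    | zero => exact fun x => L.refl x
    | succ n ih => exact fun x => L.trans (hEL (hSE x)) (ih (S x))
  have habs : AbsorbsCopies L (Y \ D) D := by
    -- Otherwise cancelling iterates of the injective `S` puts `b` in the range of `S`, hence in
    -- `D`.
    have key : ∀ n m a b, b ∉ D → S^[n + 1] a = S^[m + 1] b → n ≤ m := by
      intro n m a b hb hab
      by_contra! hlt
      obtain ⟨d, rfl⟩ := Nat.exists_eq_add_of_lt hlt
      rw [show m + d + 1 + 1 = (m + 1) + (d + 1) by ring, Function.iterate_add_apply] at hab
      have := hSi.iterate _ hab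
      rw [Function.iterate_succ_apply'] at this
      exact hb (this ▸ hSR _)
    refine ⟨fun n => S^[n + 1], fun n => hS.iterate _, fun n a _ => hSn _ a, fun n a _ => ?_, ?_⟩
    · change R (S^[n + 1] a) (S^[n + 1] a)
      rw [Function.iterate_succ_apply']
      exact hSR _
    · intro n m a ha b hb hab
      obtain rfl : n = m := le_antisymm (key n m a b hb.2 hab) (key m n b a ha.2 hab.symm)
      exact ⟨rfl, hSi.iterate _ hab⟩
  have := Fintype.ofFinite H
  -- Finitely many pieces, each sent injectively into `Y ∩ D` by its `α k`, so absorption passes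
  -- from `D` to `Y ∩ D`.
  have hunion : D = ⋃ k ∈ (Finset.univ : Finset H), {x | x ∈ D ∧ α k • x ∈ Y} := by
    ext x
    simp only [Finset.mem_univ, Set.iUnion_true, Set.mem_iUnion, Set.mem_ofPred_eq]
    exact ⟨fun hx => (hYex x).imp fun k hk => ⟨hx, hk⟩, fun ⟨k, hk⟩ => hk.1⟩
  rw [hunion] at habs
  have habs' : AbsorbsCopies L (Y \ (Y ∩ D)) (Y ∩ D) := by
    rw [Set.sdiff_self_inter]
    refine AbsorbsCopies.of_iUnion hL hLm
      (fun k => measurableSet_and hD (measurableSet_smul_mem hY (α k))) (fun k => ?_) Finset.univ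
      (hY.diff hD) (hunion ▸ habs)
    exact ⟨fun x => α k • x, measurable_const_smul _, fun c _ => hαL k c,
      fun c hc => ⟨hc.2, hDα hc.1 k⟩, (MulAction.injective _).injOn⟩
  obtain ⟨r, hrm, hr, hrex, hrsurj, hrfun, hrinj⟩ :=
    habs'.exists_bijection hL hY (hY.inter hD) Set.inter_subset_left
  -- The graph of a map onto `Y ∩ D` whose fibres are the `α`-orbits; `R'` below is the pullback of
  -- `R` along it.
  let Q : X → X → Prop := fun x z => ∃ k, α k • x ∈ Y ∧ r (α k • x) z
  have hQm : OrbitMeasurable Γ Q := fun γ => measurableSet_exists fun k =>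
    measurableSet_and (measurableSet_smul_mem hY _) (hrm.smul_smul _ _)
  have hQ : ∀ {x z}, Q x z → L x z ∧ z ∈ Y ∧ z ∈ D := by
    rintro x z ⟨k, -, hk⟩
    exact ⟨L.trans (hαL k x) (hr hk).2.2, (hr hk).2.1⟩
  have hQex : ∀ x, ∃ z, Q x z := fun x => by
    obtain ⟨k, hk⟩ := hYex x
    obtain ⟨z, hz⟩ := hrex _ hk
    exact ⟨z, k, hk, hz⟩
  have hQfun : ∀ {x z z'}, Q x z → Q x z' → z = z' := by
    rintro x z z' ⟨k, hk, hz⟩ ⟨k', hk', hz'⟩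
    have e := hYuniq (k' * k⁻¹) _ hk (by simpa [mul_smul] using hk')
    simp only [_root_.map_mul, _root_.map_inv, mul_smul, inv_smul_smul] at e
    exact hrfun hz (e ▸ hz')
  have hQinj : ∀ {x y z}, Q x z → Q y z → ∃ k, y = α k • x := by
    rintro x y z ⟨k, hk, hz⟩ ⟨k', hk', hz'⟩
    refine ⟨k'⁻¹ * k, ?_⟩
    rw [_root_.map_mul, mul_smul, hrinj hz hz', ← mul_smul, ← _root_.map_mul, inv_mul_cancel,
      _root_.map_one, one_smul]
  have hQsurj : ∀ z ∈ Y ∩ D, ∃ x, Q x z := fun z hz => by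
    obtain ⟨x, hx⟩ := hrsurj z hz
    exact ⟨x, 1, by simpa using (hr hx).1, by simpa using hx⟩
  have hQα : ∀ {x z} k, Q x z → Q (α k • x) z := by
    rintro x z k ⟨k', hk', hz⟩
    exact ⟨k' * k⁻¹, by simpa [mul_smul] using hk', by simpa [mul_smul] using hz⟩
  let R' : X → X → Prop := fun x y => ∃ z, Q x z ∧ ∃ z', R z z' ∧ Q y z'
  refine ⟨R', ?_, fun x => ?_⟩
  · exact
    { exists_smul := by
        rintro x y ⟨z, hxz, z', hzz', hyz'⟩
        obtain ⟨γ, rfl⟩ := hL (hQ hxz).1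
        obtain ⟨δ, rfl⟩ := hR.exists_smul hzz'
        obtain ⟨ε, rfl⟩ := hL (L.symm (hQ hyz').1)
        exact ⟨ε * (δ * γ), by simp only [mul_smul]⟩
      orbitMeasurable := hQm.comp (hR.orbitMeasurable.comp hQm.flip fun x y => hR.exists_smul)
        fun x y hxy => hL (hQ hxy).1
      symm := by
        rintro x y ⟨z, hxz, z', hzz', hyz'⟩
        exact ⟨z', hyz', z, hR.symm hzz', hxz⟩
      trans := by
        rintro x y w ⟨z, hxz, z', hzz', hyz'⟩ ⟨u, hyu, v, huv, hwv⟩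
        obtain rfl := hQfun hyz' hyu
        exact ⟨z, hxz, v, hR.trans hzz' huv, hwv⟩
      eq_of_rel := by
        rintro x y ⟨z, hxz, z', hzz', hyz'⟩ hxy
        obtain ⟨k, hk⟩ : L z z' :=
          L.trans (L.symm (hQ hxz).1) (L.trans (hEL hxy) (hQ hyz').1)
        have h1 : R (α k • z) z' := hR.trans (hR.symm (hR.map (hQ hxz).2.2 k)) hzz'
        obtain rfl := hR.eq_of_rel h1 hk
        have h2 := hYuniq k z (hQ hxz).2.1 (hQ hyz').2.1
        rw [h2] at hyz'
        obtain ⟨l, rfl⟩ := hQinj hxz hyz'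
        exact (h.classBijective l x (E.symm hxy)).symm
      exists_rel := by
        rintro x - g
        obtain ⟨z, hxz⟩ := hQex x
        obtain ⟨k, hk⟩ := (hQ hxz).1
        -- Since `z` lies in the class of `α k • x`, the factor `(f k)⁻¹` makes the target the class
        -- of `T g • x`. The point `z'` may lie outside `Y`, hence the correction by `α l`.
        obtain ⟨z', hz', hzz'⟩ := hR.exists_rel (hQ hxz).2.2 (g * (f k)⁻¹)
        have hxz' : E (T g • x) z' := by
          refine E.trans (E.symm ?_) hz'
          have h1 := h.smul (T (g * (f k)⁻¹)) (E.trans (E.symm hk) (h.map_hom k x))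
          refine E.trans h1 ?_
          have h2 := h.map_mul (g * (f k)⁻¹) (f k) x
          rwa [inv_mul_cancel_right] at h2
        have hz'D : z' ∈ D := hR.trans (hR.symm hzz') hzz'
        obtain ⟨l, hl⟩ := hYex z'
        obtain ⟨w, hw⟩ := hQsurj _ ⟨hl, hDα hz'D l⟩
        obtain ⟨m, hm⟩ : L w z' := L.trans (hQ hw).1 (L.symm (hαL l z'))
        exact ⟨α m • w, E.trans hxz' (E.symm hm), z, hxz, α l • z',
          hR.trans hzz' (hR.map hz'D l), hQα m hw⟩
      map := by
        rintro x - k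
        obtain ⟨z, hz⟩ := hQex x
        exact ⟨z, hz, z, (hQ hz).2.2, hQα k hz⟩ }
  · obtain ⟨z, hz⟩ := hQex x
    exact ⟨z, hz, z, (hQ hz).2.2, hz⟩

/-- A class-bijective action of `G` lifting the outer action and extending `α`. -/
theorem exists_action (h : OuterActionData f E T α) [Finite G] [Finite H] :
    ∃ ψ : G →* Equiv.Perm X, (∀ g, Measurable (ψ g)) ∧ (∀ g x, E (T g • x) (ψ g x)) ∧
      (∀ k x, ψ (f k) x = α k • x) ∧ ∀ g x, E (ψ g x) x → ψ g x = x := by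
  obtain ⟨R, hR, hRt⟩ := h.exists_total_transversal
  have hp : ∀ g, ∃ p : X → X, Measurable p ∧ ∀ x, E (T g • x) (p x) ∧ R x (p x) := fun g => by
    have hm : OrbitMeasurable Γ (fun x y => E (T g • x) y ∧ R x y) := fun γ =>
      measurableSet_and (h.orbitMeasurable.smul_smul _ _) (hR.orbitMeasurable γ)
    obtain ⟨p, hp, -, hpr⟩ := hm.exists_measurable
    refine ⟨p, hp, fun x => hpr x ?_⟩
    obtain ⟨y, hy, hxy⟩ := hR.exists_rel (hRt x) g
    obtain ⟨γ, rfl⟩ := hR.exists_smul hxy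
    exact ⟨γ, hy, hxy⟩
  choose p hpm hp using hp
  have huniq : ∀ {g x y}, E (T g • x) y → R x y → p g x = y := fun {g x y} h1 h2 =>
    hR.eq_of_rel (hR.trans (hR.symm (hp g x).2) h2) (E.trans (E.symm (hp g x).1) h1)
  have hone : ∀ x, p 1 x = x := fun x => huniq (h.map_one x) (hRt x)
  have hmul : ∀ g g' x, p (g * g') x = p g (p g' x) := fun g g' x =>
    huniq (E.trans (E.symm (h.map_mul g g' x)) (E.trans (h.smul _ (hp g' x).1) (hp g _).1))
      (hR.trans (hp g' x).2 (hp g _).2)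
  let ψ : G →* Equiv.Perm X :=
    { toFun := fun g => ⟨p g, p g⁻¹, fun x => by rw [← hmul, inv_mul_cancel, hone],
        fun x => by rw [← hmul, mul_inv_cancel, hone]⟩
      map_one' := Equiv.ext hone
      map_mul' := fun g g' => Equiv.ext (hmul g g') }
  exact ⟨ψ, hpm, fun g x => (hp g x).1,
    fun k x => huniq (E.symm (h.map_hom k x)) (hR.map (hRt x) k),
    fun g x hx => (hR.eq_of_rel (hp g x).2 (E.symm hx)).symm⟩

end OuterActionData

end TotalTransversal

/-! ### Finite groups and amalgamated products -/

namespace CBER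

theorem proj_eq_iff {X : Type*} [MeasurableSpace X] {E : CBER X} {S T : E.Aut} :
    E.proj S = E.proj T ↔ ∀ x, E.toSetoid (S.1 x) (T.1 x) := by
  refine QuotientGroup.eq.trans (forall_congr' fun x => ?_)
  rw [S.2.2 x]
  simp

end CBER

/-- Morphisms between finite groups have the class-bijective lifting property. -/
theorem classBijectiveLiftingProperty_of_finite.{v, w} {H : Type v} {G : Type w} [Group H]
    [Group G] [Finite H] [Finite G] (f : H →* G) : ClassBijectiveLiftingProperty.{u} f := by
  intro X _ _ E α φ hα hcb
  choose T₀ hT₀ using fun g => QuotientGroup.mk'_surjective E.Inn (φ g)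
  have hT₀m : ∀ g g' x, E.toSetoid ((T₀ g).1 ((T₀ g').1 x)) ((T₀ (g * g')).1 x) := fun g g' =>
    CBER.proj_eq_iff (S := T₀ g * T₀ g').1
      ((map_mul E.proj _ _).trans (by
        rw [CBER.proj, hT₀, hT₀, hT₀, map_mul]))
  have hT₀α : ∀ k x, E.toSetoid ((α k).1 x) ((T₀ (f k)).1 x) := fun k =>
    CBER.proj_eq_iff.1 ((DFunLike.congr_fun hα k).trans (hT₀ (f k)).symm)
  -- A countable group generated by representatives of `φ` and by `α`. Intersecting `E` with its
  -- orbit relation keeps the hypotheses and lets every existential run over a countable group.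
  let F : FreeGroup (G ⊕ H) →* E.Aut := FreeGroup.lift (Sum.elim T₀ α)
  let Γ := F.range
  have : Countable Γ := (F.rangeRestrict_surjective).countable
  have : MeasurableConstSMul Γ X := ⟨fun γ => γ.1.2.1.1⟩
  let T : G → Γ := fun g => ⟨T₀ g, FreeGroup.of (Sum.inl g), by simp [F]⟩
  let α' : H →* Γ := α.codRestrict Γ fun k => ⟨FreeGroup.of (Sum.inr k), by simp [F]⟩
  let E₀ : Setoid X := E.toSetoid ⊓ MulAction.orbitRel Γ X
  have hsmul : ∀ {x} {γ δ : Γ}, E₀ (γ • x) (δ • x) ↔ E.toSetoid (γ • x) (δ • x) := fun {x γ δ} =>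
    ⟨fun h => h.1, fun h => ⟨h, γ * δ⁻¹, by simp [mul_smul]⟩⟩
  have hdata : OuterActionData f E₀ T α' :=
    { exists_smul := by
        rintro x y ⟨-, γ, rfl⟩
        exact ⟨γ⁻¹, by simp⟩
      smul := by
        rintro γ x y ⟨h1, δ, rfl⟩
        exact ⟨(γ.1.2.2 _ _).1 h1, γ * δ * γ⁻¹, by simp [mul_smul]⟩
      orbitMeasurable := fun γ => by
        have h1 : ∀ x, E₀ x (γ • x) ↔ E.toSetoid x (γ • x) := fun x => by
          simpa using hsmul (x := x) (γ := 1) (δ := γ)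
        simp only [h1]
        exact (measurable_id.prodMk (measurable_const_smul γ)) E.measurableSet_rel
      map_mul := fun g g' x => by
        rw [← mul_smul]
        exact hsmul.2 (hT₀m g g' x)
      map_hom := fun k x => hsmul.2 (hT₀α k x)
      classBijective := fun k x hx => hcb k x hx.1 }
  obtain ⟨ψ, hψm, hψT, hψα, hψcb⟩ := hdata.exists_action
  have hψE : ∀ g x, E.toSetoid ((T₀ g).1 x) (ψ g x) := fun g x => (hψT g x).1
  let Ψ : G →* E.Aut := ψ.codRestrict E.Aut fun g => ⟨⟨hψm g, by
      have := hψm g⁻¹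
      rwa [map_inv] at this⟩, fun x y => ((T₀ g).2.2 x y).trans
      ⟨fun h => E.toSetoid.trans (E.toSetoid.symm (hψE g x)) (E.toSetoid.trans h (hψE g y)),
        fun h => E.toSetoid.trans (hψE g x) (E.toSetoid.trans h (E.toSetoid.symm (hψE g y)))⟩⟩
  refine ⟨Ψ, ?_, ?_, ?_⟩
  · ext g
    exact (CBER.proj_eq_iff.2 fun x => E.toSetoid.symm (hψE g x)).trans (hT₀ g)
  · ext k x
    exact hψα k x
  · intro g x hx
    -- `ψ g x` stays in the `Γ`-orbit of `x`, so for these two points `E` and `E₀` agree.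
    refine hψcb g x ⟨hx, ?_⟩
    obtain ⟨γ, hγ⟩ := (hψT g x).2
    exact ⟨γ⁻¹ * T g, (mul_smul γ⁻¹ (T g) x).trans (inv_smul_eq_iff.2 hγ.symm)⟩

/-- This is the lifting property of the morphism from the trivial group, whose trivial action is
class-bijective. -/
theorem everyOuterActionLiftsClassBijectively_of_finite.{v} {G : Type v} [Group G] [Finite G] :
    EveryOuterActionLiftsClassBijectively.{u} G := by
  intro X _ _ E φ
  obtain ⟨ψ, h1, -, h2⟩ := classBijectiveLiftingProperty_of_finite (1 : Unit →* G) X E 1 φ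
    (by ext; simp) (fun _ _ _ => rfl)
  exact ⟨ψ, h1, h2⟩

/-- The lifts on the factors all restrict to the same `α` on `H`, hence factor through the pushout;
class-bijectivity of `α` is what allows each extension. -/
theorem everyOuterActionLifts_pushoutI.{v, w, z} {ι : Type v} {H : Type w} [Group H]
    {G : ι → Type z} [∀ n, Group (G n)] (f : ∀ n, H →* G n)
    (hH : EveryOuterActionLiftsClassBijectively.{u} H)
    (hf : ∀ n, ClassBijectiveLiftingProperty.{u} (f n)) :
    EveryOuterActionLifts.{u} (Monoid.PushoutI f) := by
  intro X _ _ E φ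
  obtain ⟨α, hα, hcb⟩ := hH X E (φ.comp (Monoid.PushoutI.base f))
  choose ψ hψ hψf _ using fun n => hf n X E α (φ.comp (Monoid.PushoutI.of n))
    (by rw [hα, MonoidHom.comp_assoc, Monoid.PushoutI.of_comp_eq_base]) hcb
  refine ⟨Monoid.PushoutI.lift ψ α hψf, Monoid.PushoutI.hom_ext (fun n => ?_) ?_⟩
  · rw [← hψ n]
    ext x
    simp
  · rw [← hα]
    ext x
    simp

theorem mainTheorem11 {ι : Type*} [Countable ι]
    {H : Type*} [Group H] [Countable H]
    {G : ι → Type*} [∀ n, Group (G n)] [∀ n, Countable (G n)]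
    (f : ∀ n, H →* G n) :
    (EveryOuterActionLiftsClassBijectively.{u} H →
      (∀ n, ClassBijectiveLiftingProperty.{u} (f n)) →
        EveryOuterActionLifts.{u} (Monoid.PushoutI f)) ∧
    (Finite H → (∀ n, Finite (G n)) →
      EveryOuterActionLifts.{u} (Monoid.PushoutI f)) :=
  ⟨everyOuterActionLifts_pushoutI f, fun _ _ => everyOuterActionLifts_pushoutI f
    everyOuterActionLiftsClassBijectively_of_finite
    fun n => classBijectiveLiftingProperty_of_finite (f n)⟩
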